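/- Let $P$ be a finite pure poset of rank $r\in\mathbb{N}_0$, i.e. every maximal chain of $P$ has exactly $r+1$ elements, and let $\mathbb{K}$ be a field. Let $\rho:P\to\mathbb{N}_0$ be its (unique) rank function: $\rho(m)=0$ for every minimal element $m$, and $\rho(y)=\rho(x)+1$ whenever $y$ covers $x$. Put $P_i=\{a\in P : \rho(a)=i\}$. For $0\le i\le r-1$ let $G_i(P)$ be the bipartite graph with parts $P_i$ and $P_{i+1}$ in which $a\in P_i$ and $b\in P_{i+1}$ are adjacent if and only if $b$ covers $a$, and let $k_i$ be the number of connected components of $G_i(P)$. The chain algebra $\mathbb{K}[C_P]$ is the $\mathbb{K}$-subalgebra of the polynomial ring $\mathbb{K}[x : x\in P]$ generated by the monomials $\prod_{x\in C}x$, where $C$ ranges over the maximal chains of $P$. The chain polytope $D_P$ is the convex hull in $\mathbb{R}^P$ of the characteristic functions of the maximal chains of $P$, and its dimension is the dimension of its affine hull. Then the Krull dimension of $\mathbb{K}[C_P]$ is $$\dim \mathbb{K}[C_P]=|P|-(k_0+\cdots+k_{r-1}),$$ and $$\dim D_P=|P|-(k_0+\cdots+k_{r-1})-1 .$$ -/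

import Mathlib

/-- A finite poset is pure (or graded) of rank `r` if every maximal chain `C` has length
`|C| - 1 = r`. -/
def IsPureOfRank (P : Type*) [PartialOrder P] (r : ℕ) : Prop :=
  ∀ C : Finset P, IsMaxChain (· ≤ ·) (C : Set P) → C.card = r + 1

/-- A rank function: minimal elements have rank `0`, and rank goes up by one along covers. -/
structure IsRankFunction {P : Type*} [PartialOrder P] (ρ : P → ℕ) : Prop where
  isMin : ∀ m : P, IsMin m → ρ m = 0
  covBy : ∀ x y : P, x ⋖ y → ρ y = ρ x + 1

/-- Replacing the lower part of a maximal chain at a common element gives a maximal chain. -/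
theorem isMaxChain_splice {P : Type*} [PartialOrder P] {M N : Set P} {a : P}
    (hM : IsMaxChain (· ≤ ·) M) (hN : IsMaxChain (· ≤ ·) N) (haM : a ∈ M) (haN : a ∈ N) :
    IsMaxChain (· ≤ ·) ({x | x ∈ M ∧ x < a} ∪ {x | x ∈ N ∧ a ≤ x}) := by
  have key : ∀ {T : Set P}, IsChain (· ≤ ·) T → ∀ {z : P}, (∀ x ∈ T, x ≤ z ∨ z ≤ x) →
      IsChain (· ≤ ·) (insert z T) := by
    intro T hT z hz
    exact hT.insert fun b hb _ => (hz b hb).symm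
  refine ⟨?_, ?_⟩
  · rintro x (⟨hx, hxa⟩ | ⟨hx, hxa⟩) y (⟨hy, hya⟩ | ⟨hy, hya⟩) hxy
    · exact hM.1 hx hy hxy
    · exact Or.inl (hxa.le.trans hya)
    · exact Or.inr (hya.le.trans hxa)
    · exact hN.1 hx hy hxy
  · intro T hT hsub
    refine Set.Subset.antisymm hsub fun z hz => ?_
    have haT : a ∈ T := hsub (Or.inr ⟨haN, le_rfl⟩)
    by_cases hza : z < a
    · left
      refine ⟨?_, hza⟩
      have : IsChain (· ≤ ·) (insert z M) := key hM.1 fun x hx => by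
        by_cases hxa : x < a
        · exact hT.total (hsub (Or.inl ⟨hx, hxa⟩)) hz
        · right
          rcases hM.1.total hx haM with h | h
          · exact hza.le.trans (h.lt_or_eq.resolve_left hxa).ge
          · exact hza.le.trans h
      rw [hM.2 this (Set.subset_insert _ _)]
      exact Set.mem_insert _ _
    · right
      have haz : a ≤ z := by
        rcases hT.total haT hz with h | h
        · exact h
        · exact (h.lt_or_eq.resolve_left hza).ge
      refine ⟨?_, haz⟩
      have : IsChain (· ≤ ·) (insert z N) := key hN.1 fun x hx => by
        by_cases hax : a ≤ x
        · exact hT.total (hsub (Or.inr ⟨hx, hax⟩)) hz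
        · left
          exact ((hN.1.total haN hx).resolve_left hax).trans haz
      rw [hN.2 this (Set.subset_insert _ _)]
      exact Set.mem_insert _ _

/-- Every finite pure poset has exactly one rank function. -/
theorem IsPureOfRank.existsUnique_rankFunction {P : Type*} [PartialOrder P] [Finite P] {r : ℕ}
    (hP : IsPureOfRank P r) : ∃! ρ : P → ℕ, IsRankFunction ρ := by
  classical
  have := Fintype.ofFinite P
  have hcard : ∀ {M : Set P}, IsMaxChain (· ≤ ·) M → M.ncard = r + 1 := by
    intro M hM
    rw [Set.ncard_eq_toFinset_card']
    exact hP _ (by simpa using hM)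
  have hsplit : ∀ {M N : Set P} {a : P},
      ({x | x ∈ M ∧ x < a} ∪ {x | x ∈ N ∧ a ≤ x} : Set P).ncard =
        {x | x ∈ M ∧ x < a}.ncard + {x | x ∈ N ∧ a ≤ x}.ncard := by
    intro M N a
    refine Set.ncard_union_eq ?_ (Set.toFinite _) (Set.toFinite _)
    rw [Set.disjoint_left]
    rintro x ⟨-, h⟩ ⟨-, h'⟩
    exact absurd h h'.not_gt
  have hlow : ∀ {M N : Set P} {a : P}, IsMaxChain (· ≤ ·) M → IsMaxChain (· ≤ ·) N → a ∈ M →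
      a ∈ N → {x | x ∈ M ∧ x < a}.ncard = {x | x ∈ N ∧ x < a}.ncard := by
    intro M N a hM hN haM haN
    have h1 := hcard (isMaxChain_splice hM hN haM haN)
    have h2 := hcard (isMaxChain_splice hN hN haN haN)
    rw [hsplit] at h1 h2
    omega
  have hex : ∀ a : P, ∃ M : Set P, IsMaxChain (· ≤ ·) M ∧ a ∈ M := by
    intro a
    obtain ⟨M, hM, hs⟩ := (IsChain.singleton (r := (· ≤ ·)) (a := a)).exists_maxChain
    exact ⟨M, hM, hs rfl⟩
  choose M hM haM using hex
  have huniq : ∀ τ τ' : P → ℕ, IsRankFunction τ → IsRankFunction τ' → ∀ x, τ x = τ' x := by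
    intro τ τ' hτ hτ' x
    induction x using WellFoundedLT.induction with
    | ind x ih =>
      by_cases hx : IsMin x
      · rw [hτ.isMin x hx, hτ'.isMin x hx]
      · obtain ⟨y, hy⟩ := exists_covBy_of_wellFoundedGT hx
        rw [hτ.covBy y x hy, hτ'.covBy y x hy, ih y hy.lt]
  refine existsUnique_of_exists_of_unique
    ⟨fun a => {x | x ∈ M a ∧ x < a}.ncard, ⟨?_, ?_⟩⟩ fun τ τ' hτ hτ' => funext (huniq τ τ' hτ hτ')
  · intro m hm
    have : {x | x ∈ M m ∧ x < m} = ∅ := by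
      ext x
      simp only [Set.mem_setOf_eq, Set.mem_empty_iff_false, iff_false, not_and]
      exact fun _ => hm.not_lt
    simp [this]
  · intro x y hxy
    obtain ⟨N, hN, hs⟩ := (IsChain.pair (r := (· ≤ ·)) hxy.le).exists_maxChain
    have hxN : x ∈ N := hs (by simp)
    have hyN : y ∈ N := hs (by simp)
    change {z | z ∈ M y ∧ z < y}.ncard = {z | z ∈ M x ∧ z < x}.ncard + 1
    rw [hlow (hM y) hN (haM y) hyN, hlow (hM x) hN (haM x) hxN,
      ← Set.ncard_insert_of_notMem (a := x) (by simp)]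
    congr 1
    ext z
    simp only [Set.mem_setOf_eq, Set.mem_insert_iff]
    constructor
    · rintro ⟨hz, hzy⟩
      rcases hN.1.total hz hxN with h | h
      · exact h.eq_or_lt.imp_right fun h => ⟨hz, h⟩
      · exact Or.inl (h.eq_or_lt.resolve_right fun h => hxy.2 h hzy).symm
    · rintro (rfl | ⟨hz, hzx⟩)
      · exact ⟨hxN, hxy.lt⟩
      · exact ⟨hz, hzx.trans hxy.lt⟩

/-- The bipartite graph `G_i(P)` with parts `P_i` and `P_{i+1}` (the elements of rank `i` and
`i + 1`), where `a ∈ P_i` and `b ∈ P_{i+1}` are adjacent if and only if `b` covers `a`. -/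
def coverGraph {P : Type*} [PartialOrder P] (ρ : P → ℕ) (i : ℕ) :
    SimpleGraph {x : P // ρ x = i ∨ ρ x = i + 1} where
  Adj a b :=
    (ρ a.1 = i ∧ ρ b.1 = i + 1 ∧ a.1 ⋖ b.1) ∨ (ρ b.1 = i ∧ ρ a.1 = i + 1 ∧ b.1 ⋖ a.1)
  symm := ⟨fun _ _ h => h.symm⟩
  loopless := ⟨fun _ h => h.elim (fun h => h.2.2.lt.ne rfl) (fun h => h.2.2.lt.ne rfl)⟩

/-- `k_i`, the number of connected components of `G_i(P)`. -/
noncomputable def numComponents {P : Type*} [PartialOrder P] (ρ : P → ℕ) (i : ℕ) : ℕ :=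
  Nat.card (coverGraph ρ i).ConnectedComponent

/-- The chain algebra: the subalgebra of the polynomial ring `K[x : x ∈ P]` generated by the
monomials `∏ x ∈ C, x`, for the maximal chains `C` of `P`. -/
noncomputable def chainAlgebra (K P : Type*) [Field K] [PartialOrder P] :
    Subalgebra K (MvPolynomial P K) :=
  Algebra.adjoin K {m | ∃ C : Finset P, IsMaxChain (· ≤ ·) (C : Set P) ∧
    m = ∏ x ∈ C, MvPolynomial.X x}

/-- The chain polytope: the convex hull in `ℝ^P` of the characteristic functions of the maximal
chains of `P`. -/
noncomputable def chainPolytope (P : Type*) [PartialOrder P] : Set (P → ℝ) :=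
  convexHull ℝ {f | ∃ C : Set P, IsMaxChain (· ≤ ·) C ∧ f = C.indicator 1}

/-- The dimension of a (non-empty) convex set: the dimension of its affine hull. -/
noncomputable def affineDim {V : Type*} [AddCommGroup V] [Module ℝ V] (D : Set V) : ℕ :=
  Module.finrank ℝ (affineSpan ℝ D).direction

/-! Both dimensions come from the rank of the incidence matrix of maximal chains against elements.
The Krull dimension of an algebra generated by finitely many monomials is its transcendence degree,
hence the rational rank of the exponent vectors (`ringKrullDim_adjoin_monomial`). The indicator
vectors lie in the hyperplane where the coordinates sum to `r + 1`, so their affine dimension is one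
less than their linear rank (`finrank_vectorSpan_add_one`).

By rank-nullity it remains to see that the kernel, the weights `w` with sum zero on every maximal
chain, has dimension `∑ k_i` (`finrank_chainAnnihilator`). For such `w`, the partial sum `s a` up to
`a` is the same along all maximal chains through `a`, by splicing. If `b` covers `a`, then `s a = s
b - w b`, so `s` yields one constant per component of each `G_i`. Conversely, arbitrary constants,
extended by `0` at both ends, give a kernel element: at each element, the constant above minus the
constant below. -/

/-! ### Krull dimension and transcendence degree. -/

theorem ringKrullDim_eq_of_isIntegral (R S : Type*) [CommRing R] [CommRing S] [Algebra R S]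
    [Algebra.IsIntegral R S] [FaithfulSMul R S] : ringKrullDim S = ringKrullDim R := by
  refine le_antisymm (Order.krullDim_le_of_strictMono (PrimeSpectrum.comap (algebraMap R S))
    fun I J h => ?_) (iSup_le fun l => ?_)
  -- Incomparability gives `≤`; lying over and going up lift prime chains for `≥`.
  · exact Ideal.IsIntegral.comap_lt_comap (R := R) h
  · obtain ⟨⟨Q, hQ, hQl⟩⟩ := Ideal.nonempty_primesOver (S := S) l.head.asIdeal
    obtain ⟨L, hL, -⟩ := Ideal.exists_ltSeries_of_hasGoingUp l Q
    rw [← hL]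
    exact Order.LTSeries.length_le_krullDim L

/-- The Krull dimension of a finitely generated domain over a field is its transcendence degree. -/
theorem ringKrullDim_eq_of_trdeg_eq {K A : Type*} [Field K] [CommRing A] [IsDomain A] [Algebra K A]
    [Algebra.FiniteType K A] {n : ℕ} (h : Algebra.trdeg K A = n) : ringKrullDim A = n := by
  obtain ⟨s, g, hg, hfin⟩ := exists_finite_inj_algHom_of_fg K A
  algebraize [g.toRingHom]
  have : FaithfulSMul (MvPolynomial (Fin s) K) A :=
    (faithfulSMul_iff_algebraMap_injective _ _).2 hg
  have : Algebra.IsIntegral (MvPolynomial (Fin s) K) A := ⟨hfin.to_isIntegral⟩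
  have hb := (IsTranscendenceBasis.mvPolynomial (Fin s) K).algebraMap_comp (A := A)
  have hs : s = n := by
    have := hb.lift_cardinalMk_eq_trdeg
    rw [h] at this
    simpa using this
  rw [ringKrullDim_eq_of_isIntegral (MvPolynomial (Fin s) K) A,
    MvPolynomial.ringKrullDim_of_isNoetherianRing, ringKrullDim_eq_zero_of_field]
  simp [hs]

/-! ### Monomial algebras and their exponent vectors. -/

theorem algebraicIndependent_monomial_iff {ι σ K : Type*} [Field K] (v : ι → σ →₀ ℕ) :
    AlgebraicIndependent K (fun i => MvPolynomial.monomial (v i) (1 : K)) ↔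
      LinearIndependent ℕ v := by
  have hmon : ∀ (m : ι →₀ ℕ) (c : K),
      MvPolynomial.aeval (fun i => MvPolynomial.monomial (v i) (1 : K))
        (MvPolynomial.monomial m c) =
      MvPolynomial.monomial (Finsupp.linearCombination ℕ v m) c := by
    intro m c
    rw [MvPolynomial.aeval_monomial, Finsupp.linearCombination_apply,
      MvPolynomial.monomial_finsupp_sum_index]
    simp [MvPolynomial.monomial_pow, MvPolynomial.algebraMap_eq]
  rw [AlgebraicIndependent, LinearIndependent]
  constructor
  · intro h m n hmn
    refine MvPolynomial.monomial_left_injective (one_ne_zero (α := K)) (h ?_)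
    rw [hmon, hmon, hmn]
  · intro h
    -- Distinct monomials have distinct images, so nothing cancels and each coefficient of `p`
    -- survives.
    have hcoeff : ∀ (p : MvPolynomial ι K) (m : ι →₀ ℕ),
        (MvPolynomial.aeval (fun i => MvPolynomial.monomial (v i) (1 : K)) p).coeff
          (Finsupp.linearCombination ℕ v m) = p.coeff m := by
      intro p m
      classical
      induction p using MvPolynomial.monomial_add_induction_on with
      | C a =>
        rw [← MvPolynomial.monomial_zero', hmon, MvPolynomial.coeff_monomial,
          MvPolynomial.coeff_monomial]
        simp only [h.eq_iff]
      | monomial_add a b f _ _ hf =>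
        rw [map_add, MvPolynomial.coeff_add, MvPolynomial.coeff_add, hmon, hf]
        simp [MvPolynomial.coeff_monomial, h.eq_iff]
    intro p q hpq
    ext m
    rw [← hcoeff p, ← hcoeff q, hpq]

/-- After clearing denominators, the positive and negative parts of a rational relation are two
equal combinations over `ℕ`. -/
theorem linearIndependent_nat_iff {ι σ : Type*} [Finite ι] (v : ι → σ →₀ ℕ) :
    LinearIndependent ℕ v ↔ LinearIndependent ℚ (fun i x => (v i x : ℚ)) := by
  have := Fintype.ofFinite ι
  rw [Fintype.linearIndependent_iffₛ]
  constructor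
  · intro h
    suffices LinearIndependent ℤ (fun i x => (v i x : ℚ)) from
      (LinearIndependent.iff_fractionRing ℤ ℚ).1 this
    rw [Fintype.linearIndependent_iff]
    intro g hg i
    have key : ∑ i, (g i).toNat • v i = ∑ i, (-g i).toNat • v i := by
      ext x
      have hx := congrFun hg x
      simp only [Finset.sum_apply, zsmul_eq_mul, Pi.zero_apply] at hx
      simp only [Finsupp.coe_finsetSum, Finset.sum_apply, Finsupp.smul_apply, smul_eq_mul]
      rw [← Nat.cast_inj (R := ℤ), ← sub_eq_zero]
      push_cast
      rw [← Finset.sum_sub_distrib]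
      simp_rw [← sub_mul, Int.toNat_sub_toNat_neg]
      have hx' : ∑ i, (g i : ℚ) * v i x = 0 := by simpa using hx
      exact_mod_cast hx'
    have := h _ _ key i
    omega
  · intro h f g hfg i
    rw [Fintype.linearIndependent_iff] at h
    have := h (fun i => (f i : ℚ) - g i) (by
      ext x
      have hx := DFunLike.congr_fun hfg x
      simp only [Finsupp.coe_finsetSum, Finset.sum_apply, Finsupp.smul_apply, smul_eq_mul] at hx
      simp only [Finset.sum_apply, Pi.smul_apply, smul_eq_mul, Pi.zero_apply, sub_mul,
        Finset.sum_sub_distrib, sub_eq_zero]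
      exact_mod_cast hx) i
    exact_mod_cast sub_eq_zero.1 this

theorem algebraicIndependent_mk_monomial_iff {ι κ σ K : Type*} [Field K] [Finite κ]
    (v : ι → σ →₀ ℕ) {A : Subalgebra K (MvPolynomial σ K)}
    (hA : ∀ i, MvPolynomial.monomial (v i) (1 : K) ∈ A) (a : κ → ι) :
    AlgebraicIndependent K ((fun i => (⟨_, hA i⟩ : A)) ∘ a) ↔
      LinearIndependent ℚ ((fun i x => (v i x : ℚ)) ∘ a) := by
  rw [← A.val.algebraicIndependent_iff Subtype.val_injective]
  exact (algebraicIndependent_monomial_iff (v ∘ a)).trans (linearIndependent_nat_iff (v ∘ a))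

/-- A transcendence basis can be chosen among the generators, and the algebraically independent
families of generators are those with linearly independent exponents. -/
theorem trdeg_adjoin_monomial {ι σ K : Type*} [Field K] [Finite ι] [Finite σ] (v : ι → σ →₀ ℕ) :
    Algebra.trdeg K (Algebra.adjoin K
      (Set.range fun i => MvPolynomial.monomial (v i) (1 : K))) =
    (Module.finrank ℚ (Submodule.span ℚ (Set.range fun i x => (v i x : ℚ))) : Cardinal) := by
  set S := Set.range fun i => MvPolynomial.monomial (v i) (1 : K) with hS
  let A := Algebra.adjoin K S
  let y : ι → A := fun i => ⟨_, Algebra.subset_adjoin ⟨i, rfl⟩⟩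
  have htop : Algebra.adjoin K (Set.range y) = ⊤ := by
    rw [← Algebra.adjoin_adjoin_coe_preimage (s := S)]
    congr 1
    ext ⟨z, hz⟩
    simp [y, hS, Subtype.ext_iff]
  refine le_antisymm ?_ ?_
  · have : Algebra.IsAlgebraic (Algebra.adjoin K (Set.range y)) A := by
      rw [htop]
      have := Algebra.isIntegral_of_surjective (R := (⊤ : Subalgebra K A)) (B := A)
        (fun z => ⟨⟨z, trivial⟩, rfl⟩)
      exact Algebra.IsIntegral.isAlgebraic
    obtain ⟨t, hts, ht⟩ := exists_isTranscendenceBasis_subset (R := K) (A := A) (Set.range y)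
    have hfin : Finite t := (Set.finite_range y).subset hts
    have := Fintype.ofFinite t
    choose a ha using fun z : t => hts z.2
    have hli : LinearIndependent ℚ ((fun i x => (v i x : ℚ)) ∘ a) := by
      have h1 : y ∘ a = Subtype.val := funext ha
      exact (algebraicIndependent_mk_monomial_iff v (A := A) _ a).1 (h1 ▸ ht.1)
    rw [← ht.cardinalMk_eq_trdeg, Cardinal.mk_fintype, Nat.cast_le,
      ← finrank_span_eq_card hli]
    exact Submodule.finrank_mono (Submodule.span_mono (Set.range_comp_subset_range _ _))
  · obtain ⟨κ, a, hinj, hspan, hli⟩ := exists_linearIndependent' ℚ (fun i x => (v i x : ℚ))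
    have : Finite κ := Finite.of_injective a hinj
    have := Fintype.ofFinite κ
    rw [← hspan, finrank_span_eq_card hli]
    have := ((algebraicIndependent_mk_monomial_iff v (A := A)
      (fun i => Algebra.subset_adjoin ⟨i, rfl⟩) a).2 hli).lift_cardinalMk_le_trdeg
    simpa using this

/-- The Krull dimension of an algebra generated by finitely many monomials is the rank of the
exponent vectors. -/
theorem ringKrullDim_adjoin_monomial {ι σ K : Type*} [Field K] [Finite ι] [Finite σ]
    (v : ι → σ →₀ ℕ) :
    ringKrullDim (Algebra.adjoin K
      (Set.range fun i => MvPolynomial.monomial (v i) (1 : K))) =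
    Module.finrank ℚ (Submodule.span ℚ (Set.range fun i x => (v i x : ℚ))) := by
  have : Algebra.FiniteType K (Algebra.adjoin K
      (Set.range fun i => MvPolynomial.monomial (v i) (1 : K))) :=
    Subalgebra.fg_iff_finiteType _ |>.1 ⟨(Set.finite_range fun i => MvPolynomial.monomial (v i) (1 : K)).toFinset, by simp⟩
  exact ringKrullDim_eq_of_trdeg_eq (trdeg_adjoin_monomial v)

/-- Spanning vectors in an affine hyperplane off the origin: the affine dimension is one less than
the linear dimension. -/
theorem finrank_vectorSpan_add_one {k V : Type*} [Field k] [AddCommGroup V] [Module k V]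
    [FiniteDimensional k V] {S : Set V} (hS : S.Nonempty) (φ : V →ₗ[k] k)
    (hφ : ∀ s ∈ S, φ s = 1) :
    Module.finrank k (vectorSpan k S) + 1 = Module.finrank k (Submodule.span k S) := by
  obtain ⟨p, hp⟩ := hS
  -- Differences die under `φ` while `p` does not, so the line through `p` is a complement of
  -- `vectorSpan k S` in the span.
  have hvec : vectorSpan k S ≤ LinearMap.ker φ := by
    rw [vectorSpan_eq_span_vsub_set_right k hp, Submodule.span_le]
    rintro _ ⟨s, hs, rfl⟩
    simp [hφ s hs, hφ p hp]
  have hp0 : p ≠ 0 := by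
    rintro rfl
    simpa using hφ 0 hp
  have hinf : vectorSpan k S ⊓ Submodule.span k {p} = ⊥ := by
    rw [eq_bot_iff]
    rintro x ⟨hx, hx'⟩
    obtain ⟨c, rfl⟩ := Submodule.mem_span_singleton.1 hx'
    have := hvec hx
    simp only [LinearMap.mem_ker, map_smul, hφ p hp, smul_eq_mul, mul_one] at this
    simp [this]
  have hsup : vectorSpan k S ⊔ Submodule.span k {p} = Submodule.span k S := by
    refine le_antisymm (sup_le ?_ (Submodule.span_mono (by simpa using hp))) ?_
    · rw [vectorSpan_eq_span_vsub_set_right k hp, Submodule.span_le]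
      rintro _ ⟨s, hs, rfl⟩
      exact sub_mem (Submodule.subset_span hs) (Submodule.subset_span hp)
    · rw [Submodule.span_le]
      intro s hs
      rw [← sub_add_cancel s p]
      exact add_mem (Submodule.mem_sup_left (vsub_mem_vectorSpan k hs hp))
        (Submodule.mem_sup_right (Submodule.mem_span_singleton_self p))
  have := Submodule.finrank_sup_add_finrank_inf_eq (vectorSpan k S) (Submodule.span k {p})
  rw [hinf, hsup, finrank_bot, finrank_span_singleton hp0] at this
  omega

/-! ### Sums along maximal chains. -/

section MaxChain

variable {P : Type*} [PartialOrder P]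

theorem exists_isMaxChain_superset_finset [Finite P] {s : Set P} (hs : IsChain (· ≤ ·) s) :
    ∃ C : Finset P, IsMaxChain (· ≤ ·) (C : Set P) ∧ s ⊆ C := by
  obtain ⟨M, hM, hsM⟩ := hs.exists_maxChain
  exact ⟨(Set.toFinite M).toFinset, by simpa using hM, by simpa using hsM⟩

theorem IsMaxChain.mem_of_forall {M : Set P} (hM : IsMaxChain (· ≤ ·) M) {z : P}
    (hz : ∀ x ∈ M, x ≤ z ∨ z ≤ x) : z ∈ M := by
  rw [hM.2 (hM.1.insert fun b hb _ => (hz b hb).symm) (Set.subset_insert _ _)]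
  exact Set.mem_insert _ _

/-- An element of `P` strictly between `x` and its predecessor in `C` would be comparable to all of
`C`. -/
theorem IsMaxChain.exists_covBy {C : Finset P} (hC : IsMaxChain (· ≤ ·) (C : Set P)) {x : P}
    (hx : x ∈ C) (hmin : ¬ IsMin x) : ∃ y ∈ C, y ⋖ x := by
  classical
  have hne : (C.filter (· < x)).Nonempty := by
    by_contra hne
    rw [Finset.not_nonempty_iff_eq_empty, Finset.filter_eq_empty_iff] at hne
    obtain ⟨z, hz⟩ := not_isMin_iff.1 hmin
    refine hne (hC.mem_of_forall fun b hb => Or.inr ?_) hz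
    exact hz.le.trans ((hC.1.total hx hb).elim id fun h => (h.lt_or_eq.resolve_left (hne hb)).ge)
  obtain ⟨y, hy⟩ := (C.filter (· < x)).exists_maximal hne
  obtain ⟨hyC, hyx⟩ := Finset.mem_filter.1 hy.1
  refine ⟨y, hyC, hyx, fun z hyz hzx => ?_⟩
  have hzC : z ∈ C := hC.mem_of_forall fun b hb => by
    by_cases hbx : b < x
    · left
      rcases hC.1.total hb hyC with h | h
      · exact h.trans hyz.le
      · exact (hy.2 (Finset.mem_filter.2 ⟨hb, hbx⟩) h).trans hyz.le
    · right
      exact hzx.le.trans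
        ((hC.1.total hx hb).elim id fun h => (h.lt_or_eq.resolve_left hbx).ge)
  exact hyz.not_ge (hy.2 (Finset.mem_filter.2 ⟨hzC, hzx⟩) hyz.le)

theorem IsMaxChain.exists_isMax [Nonempty P] {C : Finset P}
    (hC : IsMaxChain (· ≤ ·) (C : Set P)) : ∃ x ∈ C, IsMax x ∧ ∀ z ∈ C, z ≤ x := by
  have hne : C.Nonempty := by
    by_contra hne
    rw [Finset.not_nonempty_iff_eq_empty] at hne
    subst hne
    obtain ⟨x⟩ := ‹Nonempty P›
    simpa using hC.mem_of_forall (z := x) (by simp)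
  obtain ⟨x, hx⟩ := C.exists_maximal hne
  have hle : ∀ z ∈ C, z ≤ x := fun z hz =>
    (hC.1.total hz hx.1).elim id fun h => hx.2 hz h
  refine ⟨x, hx.1, fun b hb => ?_, hle⟩
  exact hle b (hC.mem_of_forall fun z hz => Or.inl ((hle z hz).trans hb))

theorem IsMaxChain.filter_le_of_covBy [DecidableEq P] [DecidableLE P] {C : Finset P} (hC : IsMaxChain (· ≤ ·) (C : Set P))
    {x y : P} (hx : x ∈ C) (hy : y ∈ C) (hyx : y ⋖ x) :
    C.filter (· ≤ x) = insert x (C.filter (· ≤ y)) := by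
  ext z
  simp only [Finset.mem_filter, Finset.mem_insert]
  constructor
  · rintro ⟨hz, hzx⟩
    refine hzx.eq_or_lt.imp_right fun h => ⟨hz, ?_⟩
    rcases hC.1.total hz hy with h' | h'
    · exact h'
    · exact (h'.eq_or_lt.resolve_right fun h'' => hyx.2 h'' h).ge
  · rintro (rfl | ⟨hz, hzy⟩)
    · exact ⟨hx, le_rfl⟩
    · exact ⟨hz, hzy.trans hyx.le⟩

/-- A potential whose increments along covers are `w` is the partial sum of `w` along maximal
chains. -/
theorem IsMaxChain.sum_filter_le [Finite P] [DecidableLE P] {M : Type*} [AddCommMonoid M] {C : Finset P}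
    (hC : IsMaxChain (· ≤ ·) (C : Set P)) {s w : P → M} (hmin : ∀ x, IsMin x → s x = w x)
    (hcov : ∀ x y, x ⋖ y → s y = s x + w y) {x : P} (hx : x ∈ C) :
    ∑ z ∈ C with z ≤ x, w z = s x := by
  classical
  induction x using WellFoundedLT.induction with
  | ind x ih =>
    by_cases hm : IsMin x
    · rw [hmin x hm, Finset.sum_eq_single_of_mem x (by simp [hx])]
      intro b hb hne
      exact absurd (hm.eq_of_le (Finset.mem_filter.1 hb).2) hne
    · obtain ⟨y, hy, hyx⟩ := hC.exists_covBy hx hm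
      rw [hC.filter_le_of_covBy hx hy hyx, Finset.sum_insert (by simp [hyx.lt.not_ge]),
        ih y hyx.lt hy, hcov y x hyx, add_comm]

/-- The parts of `C` and `D` below `a` both complete the same upper part of `D` to a maximal chain.
This makes the potential of `w` well defined. -/
theorem sum_filter_le_eq_of_sum_eq_zero [Finite P] [DecidableLE P] {M : Type*} [AddCommGroup M] {w : P → M}
    (hw : ∀ C : Finset P, IsMaxChain (· ≤ ·) (C : Set P) → ∑ x ∈ C, w x = 0)
    {C D : Finset P} (hC : IsMaxChain (· ≤ ·) (C : Set P)) (hD : IsMaxChain (· ≤ ·) (D : Set P))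
    {a : P} (haC : a ∈ C) (haD : a ∈ D) :
    ∑ z ∈ C with z ≤ a, w z = ∑ z ∈ D with z ≤ a, w z := by
  classical
  have key : ∀ {C : Finset P}, IsMaxChain (· ≤ ·) (C : Set P) → a ∈ C →
      ∑ z ∈ C with z < a, w z + ∑ z ∈ D with a ≤ z, w z = 0 := by
    intro C hC haC
    rw [← Finset.sum_union, ← hw (C.filter (· < a) ∪ D.filter (a ≤ ·))]
    · simpa using isMaxChain_splice hC hD haC haD
    · rw [Finset.disjoint_left]
      intro x hx hx'
      exact (Finset.mem_filter.1 hx).2.not_ge (Finset.mem_filter.1 hx').2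
  have hle : ∀ {C : Finset P}, a ∈ C →
      ∑ z ∈ C with z ≤ a, w z = w a + ∑ z ∈ C with z < a, w z := by
    intro C haC
    rw [← Finset.sum_insert (by simp)]
    congr 1
    ext z
    simp only [Finset.mem_filter, Finset.mem_insert]
    constructor
    · rintro ⟨hz, hza⟩
      exact hza.eq_or_lt.imp_right fun h => ⟨hz, h⟩
    · rintro (rfl | ⟨hz, hza⟩)
      exacts [⟨haC, le_rfl⟩, ⟨hz, hza.le⟩]
  rw [hle haC, hle haD, add_right_cancel ((key hC haC).trans (key hD haD).symm)]

end MaxChain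

/-! ### Rank functions on pure posets. -/

section Rank

variable {P : Type*} [PartialOrder P] [Finite P] {r : ℕ} {ρ : P → ℕ}

theorem IsRankFunction.isMin_iff (hρ : IsRankFunction ρ) {x : P} : IsMin x ↔ ρ x = 0 := by
  refine ⟨hρ.isMin x, fun h => ?_⟩
  by_contra hx
  obtain ⟨y, hy⟩ := exists_covBy_of_wellFoundedGT hx
  have := hρ.covBy y x hy
  omega

theorem IsRankFunction.eq_of_isMax (hρ : IsRankFunction ρ) (hP : IsPureOfRank P r) {x : P}
    (hx : IsMax x) : ρ x = r := by
  classical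
  obtain ⟨C, hC, hxC⟩ := exists_isMaxChain_superset_finset
    (IsChain.singleton (r := (· ≤ ·)) (a := x))
  have hxC : x ∈ C := hxC rfl
  -- With constant weight `1`, the potential `ρ + 1` counts the chain up to `x`.
  have h := hC.sum_filter_le (s := fun x => ρ x + 1) (w := fun _ => 1)
    (fun x hx => by simp [hρ.isMin x hx]) (fun x y h => by simp [hρ.covBy x y h]) hxC
  have hall : C.filter (· ≤ x) = C := Finset.filter_true_of_mem fun z hz =>
    (hC.1.total hz hxC).elim id fun h => hx h
  rw [hall, Finset.sum_const, hP C hC] at h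
  simpa using h.symm

theorem IsRankFunction.lt_of_not_isMax (hρ : IsRankFunction ρ) (hP : IsPureOfRank P r) {x : P}
    (hx : ¬ IsMax x) : ρ x < r := by
  induction x using WellFoundedGT.induction with
  | ind x ih =>
    obtain ⟨y, hy⟩ := exists_covBy_of_wellFoundedLT hx
    have h := hρ.covBy x y hy
    by_cases hm : IsMax y
    · have := hρ.eq_of_isMax hP hm
      omega
    · have := ih y hy.lt hm
      omega

theorem IsRankFunction.le (hρ : IsRankFunction ρ) (hP : IsPureOfRank P r) (x : P) : ρ x ≤ r := by
  by_cases hx : IsMax x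
  · exact (hρ.eq_of_isMax hP hx).le
  · exact (hρ.lt_of_not_isMax hP hx).le

end Rank

/-! ### The kernel as functions on components. -/

section Potential

variable {P F : Type*} [PartialOrder P] [Field F] {r : ℕ} {ρ : P → ℕ}

/-- The weight functions on `P` whose sum along every maximal chain vanishes. -/
def chainAnnihilator (P F : Type*) [PartialOrder P] [Field F] : Submodule F (P → F) where
  carrier := {w | ∀ C : Finset P, IsMaxChain (· ≤ ·) (C : Set P) → ∑ x ∈ C, w x = 0}
  zero_mem' := by simp
  add_mem' := by
    intro a b ha hb C hC
    simp [Finset.sum_add_distrib, ha C hC, hb C hC]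
  smul_mem' := by
    intro c a ha C hC
    simp [← Finset.mul_sum, ha C hC]

theorem mem_chainAnnihilator {w : P → F} : w ∈ chainAnnihilator P F ↔
    ∀ C : Finset P, IsMaxChain (· ≤ ·) (C : Set P) → ∑ x ∈ C, w x = 0 := Iff.rfl

/-- The value at a vertex `x` of `G_i(P)` of a function on the connected components of the
graphs `G_i(P)`. -/
def componentValue (t : (Σ i : Fin r, (coverGraph ρ i).ConnectedComponent) → F) (i : ℕ) (x : P) :
    F :=
  -- The default `0` is the boundary value at rank `r`, where no graph lies above.
  if h : i < r ∧ (ρ x = i ∨ ρ x = i + 1) then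
    t ⟨⟨i, h.1⟩, (coverGraph ρ i).connectedComponentMk ⟨x, h.2⟩⟩ else 0

theorem componentValue_of_covBy (hρ : IsRankFunction ρ)
    (t : (Σ i : Fin r, (coverGraph ρ i).ConnectedComponent) → F) {x y : P} (h : x ⋖ y) :
    componentValue t (ρ x) y = componentValue t (ρ x) x := by
  have hxy := hρ.covBy x y h
  unfold componentValue
  by_cases hr : ρ x < r
  · rw [dif_pos ⟨hr, Or.inr hxy⟩, dif_pos ⟨hr, Or.inl rfl⟩]
    congr 2
    exact SimpleGraph.ConnectedComponent.eq.2
      (SimpleGraph.Adj.reachable (Or.inr ⟨rfl, hxy, h⟩))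
  · rw [dif_neg fun h => hr h.1, dif_neg fun h => hr h.1]

/-- The value of a function on components at `x`, regarded in the graph below `x`. -/
def componentValueBelow (t : (Σ i : Fin r, (coverGraph ρ i).ConnectedComponent) → F) (x : P) : F :=
  -- Rank `0` is separate because truncated `0 - 1` would read off `G_0`.
  if ρ x = 0 then 0 else componentValue t (ρ x - 1) x

theorem componentValueBelow_of_covBy (hρ : IsRankFunction ρ)
    (t : (Σ i : Fin r, (coverGraph ρ i).ConnectedComponent) → F) {x y : P} (h : x ⋖ y) :
    componentValueBelow t y = componentValue t (ρ x) x := by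
  rw [componentValueBelow, hρ.covBy x y h, if_neg (Nat.succ_ne_zero _), Nat.add_sub_cancel,
    componentValue_of_covBy hρ t h]

/-- The weight function given by the differences, at each element, of the values on the component
above and on the component below. -/
def componentDiff (F : Type*) [Field F] (r : ℕ) (ρ : P → ℕ) :
    ((Σ i : Fin r, (coverGraph ρ i).ConnectedComponent) → F) →ₗ[F] (P → F) where
  toFun t x := componentValue t (ρ x) x - componentValueBelow t x
  map_add' s t := by
    ext x
    simp only [componentValueBelow, componentValue, Pi.add_apply]
    split_ifs <;> ring
  map_smul' c t := by
    ext x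
    simp only [componentValueBelow, componentValue, Pi.smul_apply, smul_eq_mul, RingHom.id_apply]
    split_ifs <;> ring

theorem componentDiff_apply (t : (Σ i : Fin r, (coverGraph ρ i).ConnectedComponent) → F) (x : P) :
    componentDiff F r ρ t x = componentValue t (ρ x) x - componentValueBelow t x := rfl

variable [Finite P]

/-- If all differences vanish, the boundary value `0` at minimal elements propagates up the covers
to every component. -/
theorem componentDiff_injective (hρ : IsRankFunction ρ) :
    Function.Injective (componentDiff F r ρ) := by
  rw [injective_iff_map_eq_zero]
  intro t ht
  have heq : ∀ x, componentValue t (ρ x) x = componentValueBelow t x := fun x =>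
    sub_eq_zero.1 (congrFun ht x)
  have hzero : ∀ x, componentValue t (ρ x) x = 0 := by
    intro x
    induction x using WellFoundedLT.induction with
    | ind x ih =>
      rw [heq]
      by_cases hm : IsMin x
      · rw [componentValueBelow, if_pos (hρ.isMin x hm)]
      · obtain ⟨y, hy⟩ := exists_covBy_of_wellFoundedGT hm
        rw [componentValueBelow_of_covBy hρ t hy, ih y hy.lt]
  ext ⟨⟨i, hi⟩, c⟩
  induction c using SimpleGraph.ConnectedComponent.ind with
  | h v =>
    obtain ⟨x, hx | hx⟩ := v
    · change ρ x = i at hx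
      subst hx
      have := hzero x
      rwa [componentValue, dif_pos ⟨hi, Or.inl rfl⟩] at this
    · change ρ x = i + 1 at hx
      have := (heq x).symm.trans (hzero x)
      rw [componentValueBelow, if_neg (by omega)] at this
      obtain rfl : i = ρ x - 1 := by omega
      rwa [componentValue, dif_pos ⟨hi, Or.inr hx⟩] at this

/-- The sum along a maximal chain telescopes to the boundary value `0` at its top. -/
theorem componentDiff_mem (hρ : IsRankFunction ρ) (hP : IsPureOfRank P r)
    (t : (Σ i : Fin r, (coverGraph ρ i).ConnectedComponent) → F) :
    componentDiff F r ρ t ∈ chainAnnihilator P F := by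
  classical
  intro C hC
  have : Nonempty P := by
    obtain ⟨x, -⟩ := Finset.card_pos.1 (by rw [hP C hC]; exact r.succ_pos)
    exact ⟨x⟩
  obtain ⟨x, hx, hmax, hle⟩ := hC.exists_isMax
  have h := hC.sum_filter_le (s := fun x => componentValue t (ρ x) x) (w := componentDiff F r ρ t)
    (fun x hx => by
      rw [componentDiff_apply, componentValueBelow, if_pos (hρ.isMin x hx), sub_zero])
    (fun x y h => by
      rw [componentDiff_apply, componentValueBelow_of_covBy hρ t h]
      ring) hx
  rw [Finset.filter_true_of_mem hle] at h
  rw [h, componentValue, dif_neg fun h => h.1.ne (hρ.eq_of_isMax hP hmax)]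

theorem exists_componentDiff_eq (hρ : IsRankFunction ρ) (hP : IsPureOfRank P r) {w : P → F}
    (hw : w ∈ chainAnnihilator P F) : ∃ t, componentDiff F r ρ t = w := by
  classical
  have hex : ∀ a : P, ∃ C : Finset P, IsMaxChain (· ≤ ·) (C : Set P) ∧ a ∈ C := fun a => by
    obtain ⟨C, hC, h⟩ := exists_isMaxChain_superset_finset
      (IsChain.singleton (r := (· ≤ ·)) (a := a))
    exact ⟨C, hC, h rfl⟩
  choose M hM haM using hex
  let s : P → F := fun a => ∑ z ∈ M a with z ≤ a, w z
  have hs : ∀ {C : Finset P} {a : P}, IsMaxChain (· ≤ ·) (C : Set P) → a ∈ C →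
      s a = ∑ z ∈ C with z ≤ a, w z := fun {C a} hC ha =>
    sum_filter_le_eq_of_sum_eq_zero hw (hM a) hC (haM a) ha
  have hmin : ∀ x, IsMin x → s x = w x := by
    intro x hx
    refine Finset.sum_eq_single_of_mem x (by simp [haM]) fun b hb hne => ?_
    exact absurd (hx.eq_of_le (Finset.mem_filter.1 hb).2) hne
  have hmax : ∀ x, IsMax x → s x = 0 := by
    intro x hx
    have : (M x).filter (· ≤ x) = M x := Finset.filter_true_of_mem fun z hz =>
      ((hM x).1.total hz (haM x)).elim id fun h => hx h
    change ∑ z ∈ M x with z ≤ x, w z = 0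
    rw [this, hw _ (hM x)]
  have hcov : ∀ x y, x ⋖ y → s x = s y - w y := by
    intro x y h
    obtain ⟨C, hC, hsub⟩ := exists_isMaxChain_superset_finset
      (IsChain.pair (r := (· ≤ ·)) h.le)
    have hx : x ∈ C := hsub (by simp)
    have hy : y ∈ C := hsub (by simp)
    rw [hs hC hx, hs hC hy, hC.filter_le_of_covBy hy hx h,
      Finset.sum_insert (by simp [h.lt.not_ge])]
    ring
  -- Lower vertices carry the sum through themselves, upper ones the sum stopping just before;
  -- `hcov` says these agree along edges.
  let g : ∀ i : ℕ, {x : P // ρ x = i ∨ ρ x = i + 1} → F := fun i v =>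
    if ρ v.1 = i then s v.1 else s v.1 - w v.1
  have hg : ∀ i v v', (coverGraph ρ i).Reachable v v' → g i v = g i v' := by
    intro i v v' ⟨p⟩
    induction p with
    | nil => rfl
    | cons h _ ih =>
      refine Eq.trans ?_ ih
      rcases h with ⟨h1, h2, h⟩ | ⟨h1, h2, h⟩
      · simp [g, h1, h2, hcov _ _ h]
      · simp [g, h1, h2, hcov _ _ h]
  let t : (Σ i : Fin r, (coverGraph ρ i).ConnectedComponent) → F := fun c =>
    c.2.lift (g c.1) fun v v' p _ => hg _ v v' ⟨p⟩
  have ht : ∀ i x (h : i < r ∧ (ρ x = i ∨ ρ x = i + 1)), componentValue t i x = g i ⟨x, h.2⟩ :=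
    fun i x h => dif_pos h
  refine ⟨t, ?_⟩
  ext x
  have hup : componentValue t (ρ x) x = s x := by
    by_cases hx : IsMax x
    · rw [hmax x hx, componentValue, dif_neg fun h => h.1.ne (hρ.eq_of_isMax hP hx)]
    · rw [ht _ _ ⟨hρ.lt_of_not_isMax hP hx, Or.inl rfl⟩]
      simp [g]
  have hdown : componentValueBelow t x = s x - w x := by
    by_cases hx : ρ x = 0
    · rw [componentValueBelow, if_pos hx, hmin x (hρ.isMin_iff.2 hx), sub_self]
    · have hle := hρ.le hP x
      rw [componentValueBelow, if_neg hx, ht _ _ ⟨by omega, Or.inr (by omega)⟩]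
      have : ρ x ≠ ρ x - 1 := by omega
      simp [g, this]
  rw [componentDiff_apply, hup, hdown]
  ring

theorem finrank_chainAnnihilator (hρ : IsRankFunction ρ) (hP : IsPureOfRank P r) :
    Module.finrank F (chainAnnihilator P F) = ∑ i ∈ Finset.range r, numComponents ρ i := by
  classical
  have hrange : LinearMap.range (componentDiff F r ρ) = chainAnnihilator P F := by
    refine le_antisymm ?_ fun w hw => exists_componentDiff_eq hρ hP hw
    rintro _ ⟨t, rfl⟩
    exact componentDiff_mem hρ hP t
  have hfin : ∀ i, Finite (coverGraph ρ i).ConnectedComponent := fun i => Quot.finite _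
  have := fun i => Fintype.ofFinite (coverGraph ρ i).ConnectedComponent
  rw [← hrange, LinearMap.finrank_range_of_inj (componentDiff_injective hρ),
    Module.finrank_fintype_fun_eq_card, Fintype.card_sigma, Finset.sum_range]
  simp [numComponents]

end Potential

/-- The dimension of the span of the characteristic functions of the maximal chains. -/
theorem finrank_span_chain_add {P F : Type*} [PartialOrder P] [Fintype P] [Field F] {r : ℕ}
    {ρ : P → ℕ} (hρ : IsRankFunction ρ) (hP : IsPureOfRank P r) :
    Module.finrank F (Submodule.span F (Set.range fun C :
      {C : Finset P // IsMaxChain (· ≤ ·) (C : Set P)} => (C.1 : Set P).indicator (1 : P → F))) +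
      ∑ i ∈ Finset.range r, numComponents ρ i = Fintype.card P := by
  classical
  let A : Matrix {C : Finset P // IsMaxChain (· ≤ ·) (C : Set P)} P F :=
    Matrix.of fun C => (C.1 : Set P).indicator 1
  -- The rows of `A` are the indicators, so row rank plus nullity is `|P|`.
  have hker : LinearMap.ker A.mulVecLin = chainAnnihilator P F := by
    ext w
    simp [funext_iff, mem_chainAnnihilator, A, Matrix.mulVec, dotProduct, Set.indicator_apply]
  have h := LinearMap.finrank_range_add_finrank_ker A.mulVecLin
  rw [hker, finrank_chainAnnihilator hρ hP, Module.finrank_fintype_fun_eq_card] at h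
  rw [← h]
  congr 1
  exact (Matrix.rank_eq_finrank_span_row A).symm

theorem mainTheorem2 {K P : Type*} [Field K] [PartialOrder P] [Fintype P] (r : ℕ)
    (hP : IsPureOfRank P r) (ρ : P → ℕ) (hρ : IsRankFunction ρ) :
    (∃ d : ℕ, ringKrullDim (chainAlgebra K P) = d ∧
      (d : ℤ) = (Fintype.card P : ℤ) - ∑ i ∈ Finset.range r, (numComponents ρ i : ℤ)) ∧
    (affineDim (chainPolytope P) : ℤ) =
      (Fintype.card P : ℤ) - ∑ i ∈ Finset.range r, (numComponents ρ i : ℤ) - 1 := by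
  classical
  constructor
  · refine ⟨Module.finrank ℚ (Submodule.span ℚ (Set.range fun C :
      {C : Finset P // IsMaxChain (· ≤ ·) (C : Set P)} => (C.1 : Set P).indicator (1 : P → ℚ))),
      ?_, ?_⟩
    · have halg : chainAlgebra K P = Algebra.adjoin K (Set.range fun C :
          {C : Finset P // IsMaxChain (· ≤ ·) (C : Set P)} =>
          MvPolynomial.monomial (∑ x ∈ C.1, Finsupp.single x 1) (1 : K)) := by
        rw [chainAlgebra]
        congr 1
        ext m
        simp [MvPolynomial.monomial_sum_one, MvPolynomial.X, eq_comm]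
      have hvec : (fun (C : {C : Finset P // IsMaxChain (· ≤ ·) (C : Set P)}) (x : P) =>
          (((∑ y ∈ C.1, Finsupp.single y 1 : P →₀ ℕ) x : ℕ) : ℚ)) =
          fun C => (C.1 : Set P).indicator 1 := by
        ext C x
        simp [Finsupp.single_apply, Set.indicator_apply]
      rw [halg, ringKrullDim_adjoin_monomial, hvec]
    · rw [← finrank_span_chain_add (F := ℚ) hρ hP]
      push_cast
      ring
  · have hset : {f : P → ℝ | ∃ C : Set P, IsMaxChain (· ≤ ·) C ∧ f = C.indicator 1} =
        Set.range fun C : {C : Finset P // IsMaxChain (· ≤ ·) (C : Set P)} =>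
          (C.1 : Set P).indicator (1 : P → ℝ) := by
      ext f
      constructor
      · rintro ⟨C, hC, rfl⟩
        exact ⟨⟨C.toFinset, by simpa using hC⟩, by simp⟩
      · rintro ⟨C, rfl⟩
        exact ⟨_, C.2, rfl⟩
    -- Extending the empty chain shows that the polytope has a generator.
    obtain ⟨C, hC, -⟩ := exists_isMaxChain_superset_finset (IsChain.empty (α := P) (r := (· ≤ ·)))
    have h := finrank_vectorSpan_add_one (k := ℝ)
      (S := Set.range fun C : {C : Finset P // IsMaxChain (· ≤ ·) (C : Set P)} =>
          (C.1 : Set P).indicator (1 : P → ℝ)) ⟨_, ⟨C, hC⟩, rfl⟩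
      -- Purity makes this functional equal to `1` on every indicator.
      (((r : ℝ) + 1)⁻¹ • ∑ x, LinearMap.proj x) (by
        rintro _ ⟨C, rfl⟩
        have : (r : ℝ) + 1 ≠ 0 := by positivity
        simp [Set.indicator_apply, hP _ C.2, this])
    have h' := finrank_span_chain_add (F := ℝ) hρ hP
    rw [affineDim, chainPolytope, affineSpan_convexHull, direction_affineSpan, hset, ← h']
    push_cast [← h]
    ring
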